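/- Let $A\in\mathbb C^{n\times n}$, let $\langle x,y\rangle=x^*y$, and let $\|\cdot\|$ be the Euclidean norm on $\mathbb C^n$. **Sets.** With $y=Ax$ and $x$ ranging over all vectors with $y\neq 0$, put $$\mathrm{SRG}(A)=\Big\{\tfrac{\|y\|}{\|x\|}\exp\Big(\pm i\arccos\tfrac{\mathrm{Re}\langle x,y\rangle}{\|x\|\|y\|}\Big)\Big\},\qquad \mathrm{SSG}(A)=\Big\{\tfrac{\|y\|}{\|x\|}\exp\Big(i\,\mathrm{sign}(\mathrm{Im}\langle x,y\rangle)\arccos\tfrac{\mathrm{Re}\langle x,y\rangle}{\|x\|\|y\|}\Big)\Big\},$$ $$\mathrm{NNR}(A)=\Big\{\tfrac{\langle x,y\rangle}{\|x\|\|y\|}\Big\},$$ where $\mathrm{sign}(t)=1$ for $t>0$, $\mathrm{sign}(t)=-1$ for $t<0$, and both values $\pm1$ are used for $t=0$. For $\theta\in\mathbb R$ let $\mathrm{SRG}_\theta(A)=e^{i\theta}\,\mathrm{SRG}(e^{-i\theta}A)$, and let $\mathrm{SRG}_{\theta+}(A)$ be its part in the closed half plane $e^{i\theta}\{z:\mathrm{Im}\,z\ge0\}$.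 Let $\mathrm{SSG}_{\mathrm{PI}}(A)$ and $\mathrm{SSG}_{\mathrm{NI}}(A)$ be the parts of $\mathrm{SSG}(A)$ in the closed upper and the closed lower half plane. **Textures.** A set $S\subseteq\mathbb C$ has texture $T$, where $T=(T(\xi))_{\xi\in\mathbb R}$ is a family of subsets of $\mathbb C$, if there is an interval $\Xi\subseteq\mathbb R$ (possibly empty) such that $S\subseteq\bigcup_{\xi\in\Xi}T(\xi)$ and $T(\xi)\cap S$ is nonempty and connected for every $\xi\in\Xi$. The families considered are the radar $R(\theta)=\{re^{i\theta}:r\in\mathbb R\}$, the grating $L_\varphi(k)=\{re^{i\varphi}+ke^{i(\varphi+\pi/2)}:r\in\mathbb R\}$ in direction $\varphi$, and the ripple $O_c(r)=\{z\in\mathbb C:|z-c|=r\}$ with center $c$; their parameters are $\theta$, $k$ and $r$, respectively. **Proposition.** For every $n$ and every $A\in\mathbb C^{n\times n}$: 1. For every $\theta\in\mathbb R$, the set $\mathrm{SRG}_{\theta+}(A)$ has texture $L_{\theta-\pi/2}$ and, for every $r\in\mathbb R$, texture $O_{re^{i\theta}}$. 2. Each of $\mathrm{SSG}_{\mathrm{PI}}(A)$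 and $\mathrm{SSG}_{\mathrm{NI}}(A)$ has texture $L_{\pi/2}$ and, for every $c\in\mathbb R$, texture $O_c$. 3. $\mathrm{NNR}(A)$ has texture $R$. Statements 1 and 2 also hold if, when $A$ is singular, the point $0$ is adjoined to the sets $\mathrm{SRG}_{\theta+}(A)$, $\mathrm{SSG}_{\mathrm{PI}}(A)$ and $\mathrm{SSG}_{\mathrm{NI}}(A)$ (that is, if $x$ ranges over all nonzero vectors). -/

import Mathlib

open Complex

noncomputable section

namespace Texture

/-- The graph of `A`: all pairs `(x, y)` with `y = A x`, `x` in `ℂⁿ` with the Euclidean norm. -/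
def gph {n : ℕ} (A : Matrix (Fin n) (Fin n) ℂ) :
    Set (EuclideanSpace ℂ (Fin n) × EuclideanSpace ℂ (Fin n)) :=
  {p | p.2 = Matrix.toEuclideanLin A p.1}

/-- `arccos (Re ⟨x, y⟩ / (‖x‖ ‖y‖))`, where `⟨x, y⟩ = xᴴ y`. -/
def pairAngle {n : ℕ} (x y : EuclideanSpace ℂ (Fin n)) : ℝ :=
  Real.arccos ((inner ℂ x y).re / (‖x‖ * ‖y‖))

/-- The scaled relative graph of `A`. -/
def srg {n : ℕ} (A : Matrix (Fin n) (Fin n) ℂ) : Set ℂ :=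
  {z | ∃ x y : EuclideanSpace ℂ (Fin n), (x, y) ∈ gph A ∧ y ≠ 0 ∧
    ∃ s : ℝ, (s = 1 ∨ s = -1) ∧
      z = ((‖y‖ / ‖x‖ : ℝ) : ℂ) * exp (I * ((s * pairAngle x y : ℝ) : ℂ))}

/-- The signed scaled relative graph of `A`: the sign `s` is that of `Im ⟨x, y⟩`, and both
signs are used when `Im ⟨x, y⟩ = 0`. -/
def ssg {n : ℕ} (A : Matrix (Fin n) (Fin n) ℂ) : Set ℂ :=
  {z | ∃ x y : EuclideanSpace ℂ (Fin n), (x, y) ∈ gph A ∧ y ≠ 0 ∧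
    ∃ s : ℝ, (s = 1 ∨ s = -1) ∧
      (0 < (inner ℂ x y).im → s = 1) ∧ ((inner ℂ x y).im < 0 → s = -1) ∧
      z = ((‖y‖ / ‖x‖ : ℝ) : ℂ) * exp (I * ((s * pairAngle x y : ℝ) : ℂ))}

/-- The normalized numerical range of `A`. -/
def nnr {n : ℕ} (A : Matrix (Fin n) (Fin n) ℂ) : Set ℂ :=
  {z | ∃ x y : EuclideanSpace ℂ (Fin n), (x, y) ∈ gph A ∧ y ≠ 0 ∧
    z = inner ℂ x y / ((‖x‖ * ‖y‖ : ℝ) : ℂ)}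

/-- The closed upper half plane. -/
def upperHalf : Set ℂ := {z | 0 ≤ z.im}

/-- The closed lower half plane. -/
def lowerHalf : Set ℂ := {z | z.im ≤ 0}

/-- The set `e^{iθ} S`. -/
def rotate (θ : ℝ) (S : Set ℂ) : Set ℂ := (fun z => exp (I * (θ : ℂ)) * z) '' S

/-- The `θ`-SRG of `A`, that is `e^{iθ} SRG(e^{-iθ} A)`. -/
def srgTheta {n : ℕ} (θ : ℝ) (A : Matrix (Fin n) (Fin n) ℂ) : Set ℂ :=
  rotate θ (srg (exp (-(I * (θ : ℂ))) • A))

/-- The portion of the `θ`-SRG in the closed half plane `e^{iθ} {Im z ≥ 0}`. -/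
def srgThetaPlus {n : ℕ} (θ : ℝ) (A : Matrix (Fin n) (Fin n) ℂ) : Set ℂ :=
  srgTheta θ A ∩ rotate θ upperHalf

/-- The portion of the signed SRG in the closed upper half plane. -/
def ssgPI {n : ℕ} (A : Matrix (Fin n) (Fin n) ℂ) : Set ℂ := ssg A ∩ upperHalf

/-- The portion of the signed SRG in the closed lower half plane. -/
def ssgNI {n : ℕ} (A : Matrix (Fin n) (Fin n) ℂ) : Set ℂ := ssg A ∩ lowerHalf

/-- `{0}` if `A` is singular and `∅` otherwise: the value contributed to an SRG by the
pairs `(x, 0)` of the graph with `x ≠ 0`. -/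
def kernelValue {n : ℕ} (A : Matrix (Fin n) (Fin n) ℂ) : Set ℂ :=
  {z | z = 0 ∧ ∃ x : EuclideanSpace ℂ (Fin n), x ≠ 0 ∧ (x, 0) ∈ gph A}

/-- `S` has the texture `T`: over some interval of parameters the curves `T ξ` cover `S`, and
each of them meets `S` in a (nonempty) connected set. -/
def HasTexture (T : ℝ → Set ℂ) (S : Set ℂ) : Prop :=
  ∃ Ξ : Set ℝ, Ξ.OrdConnected ∧ S ⊆ ⋃ ξ ∈ Ξ, T ξ ∧ ∀ ξ ∈ Ξ, IsConnected (T ξ ∩ S)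

/-- Radar: the lines through the origin. -/
def radar (θ : ℝ) : Set ℂ := {z | ∃ r : ℝ, z = (r : ℂ) * exp (I * (θ : ℂ))}

/-- Grating: the line of direction `e^{iφ}` at signed distance `k` from the origin. -/
def grating (φ k : ℝ) : Set ℂ :=
  {z | ∃ r : ℝ, z = (r : ℂ) * exp (I * (φ : ℂ)) +
    (k : ℂ) * exp (I * ((φ + Real.pi / 2 : ℝ) : ℂ))}

/-- Ripple: the circle of radius `r` centered at `c`. -/
def ripple (c : ℂ) (r : ℝ) : Set ℂ := {z | ‖z - c‖ = r}

end Texture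

end

/-! Gratings and ripples. Put `p = (Re ⟨x, Ax⟩, ‖Ax‖²) / ‖x‖²`. Each half of an SRG is, up to
rotation, the image of a set of such `p` under `arcPoint`, the map to the point with real part `p.1`
and squared modulus `p.2`. Vertical lines and circles with real center pull back to straight lines
in the `p` plane, since `|z - c|² = p.2 - 2 c p.1 + c²`. Hence convexity of the parameter set gives
connected intersections and an interval of parameters.

Convexity (`convex_jointRange`) is a Toeplitz–Hausdorff argument. A Hermitian form expressing
membership in the line through two values vanishes at `x` and `y`; a unit phase `w` kills its cross
term, so it vanishes along the path from `w • y` to `x`, and the intermediate value theorem fills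
the segment. The phase is free up to sign, which allows a further condition: keeping `c ≥ 0`, or
avoiding a kernel.

Radar. The same path argument shows that each line through 0 meets the normalized range in an
interval. The lines that occur are those meeting the convex set `numRange`; if 0 is not attained, a
continuous argument on it yields the interval of angles. -/

namespace Texture

/-! ### The equation of a line as a form -/

section LineForm

variable {E : Type*} [NormedAddCommGroup E]

/-- The form that vanishes on the vectors whose normalized values of `(a, b)` lie on the line
through `(α, β)` of direction `(δ, ε)`. -/
def lineForm (a b : E → ℝ) (α β δ ε : ℝ) (v : E) : ℝ :=
  ε * (a v + -α * ‖v‖ ^ 2) + -δ * (b v + -β * ‖v‖ ^ 2)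

theorem lineForm_left {a b : E → ℝ} {x : E} {α β : ℝ} (hax : a x = α * ‖x‖ ^ 2)
    (hbx : b x = β * ‖x‖ ^ 2) (δ ε : ℝ) : lineForm a b α β δ ε x = 0 := by
  rw [lineForm, hax, hbx]; ring

theorem lineForm_right {a b : E → ℝ} {y : E} {α β α' β' : ℝ} (hay : a y = α' * ‖y‖ ^ 2)
    (hby : b y = β' * ‖y‖ ^ 2) : lineForm a b α β (α' - α) (β' - β) y = 0 := by
  rw [lineForm, hay, hby]; ring

end LineForm

/-! ### Hermitian forms and convexity of joint ranges -/

section HermitianForm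

variable {E : Type*} [NormedAddCommGroup E] [InnerProductSpace ℂ E]

/-- The real-valued functions that expand like the quadratic form of a Hermitian operator. -/
def IsHermitianForm (q : E → ℝ) : Prop :=
  ∀ x y : E, ∃ ζ : ℂ, ∀ (s r : ℝ) (w : ℂ),
    q ((s : ℂ) • x + ((r : ℂ) * w) • y) =
      s ^ 2 * q x + r ^ 2 * ‖w‖ ^ 2 * q y + s * r * (w * ζ).re

theorem isHermitianForm_re_inner (S T : E →ₗ[ℂ] E) :
    IsHermitianForm fun x => (inner ℂ (S x) (T x)).re := by
  intro x y
  refine ⟨inner ℂ (S x) (T y) + (starRingEnd ℂ) (inner ℂ (S y) (T x)), fun s r w => ?_⟩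
  simp only [map_add, map_smul, inner_add_left, inner_add_right, inner_smul_left,
    inner_smul_right, map_mul, conj_ofReal]
  rw [← normSq_eq_norm_sq, normSq_apply]
  generalize inner ℂ (S x) (T y) = u1
  generalize inner ℂ (S y) (T x) = u2
  generalize inner ℂ (S x) (T x) = u3
  generalize inner ℂ (S y) (T y) = u4
  simp only [add_re, mul_re, mul_im, ofReal_re, ofReal_im, conj_re, conj_im, add_im]
  ring

theorem isHermitianForm_re (T : E →ₗ[ℂ] E) :
    IsHermitianForm fun x => (inner ℂ x (T x)).re :=
  isHermitianForm_re_inner LinearMap.id T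

theorem isHermitianForm_im (T : E →ₗ[ℂ] E) :
    IsHermitianForm fun x => (inner ℂ x (T x)).im := by
  have h := isHermitianForm_re ((-I) • T)
  simpa [inner_smul_right] using h

theorem isHermitianForm_norm_sq_apply (T : E →ₗ[ℂ] E) :
    IsHermitianForm fun x => ‖T x‖ ^ 2 := by
  have h := isHermitianForm_re_inner T T
  have e : (fun x => (inner ℂ (T x) (T x)).re) = fun x => ‖T x‖ ^ 2 := by
    funext x
    rw [inner_self_eq_norm_sq_to_K]
    norm_cast
  rwa [e] at h

theorem isHermitianForm_norm_sq : IsHermitianForm fun x : E => ‖x‖ ^ 2 :=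
  isHermitianForm_norm_sq_apply LinearMap.id

theorem IsHermitianForm.add {p q : E → ℝ} (hp : IsHermitianForm p) (hq : IsHermitianForm q) :
    IsHermitianForm fun x => p x + q x := by
  intro x y
  obtain ⟨ζ, hζ⟩ := hp x y
  obtain ⟨η, hη⟩ := hq x y
  refine ⟨ζ + η, fun s r w => ?_⟩
  simp only [hζ, hη, mul_add, add_re]
  ring

theorem IsHermitianForm.const_mul {q : E → ℝ} (hq : IsHermitianForm q) (k : ℝ) :
    IsHermitianForm fun x => k * q x := by
  intro x y
  obtain ⟨ζ, hζ⟩ := hq x y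
  refine ⟨k * ζ, fun s r w => ?_⟩
  simp only [hζ, mul_left_comm w, re_ofReal_mul]
  ring

theorem IsHermitianForm.real_smul {q : E → ℝ} (hq : IsHermitianForm q) (s : ℝ) (x : E) :
    q ((s : ℂ) • x) = s ^ 2 * q x := by
  obtain ⟨ζ, hζ⟩ := hq x x
  simpa using hζ s 0 1

theorem IsHermitianForm.smul {q : E → ℝ} (hq : IsHermitianForm q) (w : ℂ) (x : E) :
    q (w • x) = ‖w‖ ^ 2 * q x := by
  obtain ⟨ζ, hζ⟩ := hq x x
  simpa using hζ 0 1 w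

/-- The straight path from `w • y` to `x`. -/
def path (x y : E) (w : ℂ) (s : ℝ) : E := (s : ℂ) • x + (((1 - s : ℝ) : ℂ) * w) • y

theorem IsHermitianForm.continuous_path {q : E → ℝ} (hq : IsHermitianForm q) (x y : E) (w : ℂ) :
    Continuous fun s => q (path x y w s) := by
  obtain ⟨ζ, hζ⟩ := hq x y
  simp only [path, hζ]
  fun_prop

theorem IsHermitianForm.path_zero {q : E → ℝ} (hq : IsHermitianForm q) (x y : E) {w : ℂ}
    (hw : ‖w‖ = 1) : q (path x y w 0) = q y := by
  simp [path, hq.smul, hw]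

theorem path_one (x y : E) (w : ℂ) : path x y w 1 = x := by simp [path]

theorem exists_norm_one_mul_re_eq_zero (ζ : ℂ) : ∃ w : ℂ, ‖w‖ = 1 ∧ (w * ζ).re = 0 := by
  by_cases h : ζ = 0
  · exact ⟨1, by simp, by simp [h]⟩
  · have h' : ‖ζ‖ ≠ 0 := norm_ne_zero_iff.2 h
    refine ⟨I * (starRingEnd ℂ ζ) / (‖ζ‖ : ℂ), by simp [h'], ?_⟩
    rw [div_mul_eq_mul_div, mul_assoc, mul_comm (starRingEnd ℂ ζ), mul_conj, div_ofReal_re]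
    simp

/-- Only the cross term `Re (w ζ)` survives in the expansion, and rotating `ζ` onto the imaginary
axis removes it. -/
theorem IsHermitianForm.exists_phase {q : E → ℝ} (hq : IsHermitianForm q) {x y : E}
    (hx : q x = 0) (hy : q y = 0) :
    ∃ w : ℂ, ‖w‖ = 1 ∧ ∀ s r : ℝ, q ((s : ℂ) • x + ((r : ℂ) * w) • y) = 0 := by
  obtain ⟨ζ, hζ⟩ := hq x y
  obtain ⟨w, hw, hwζ⟩ := exists_norm_one_mul_re_eq_zero ζ
  exact ⟨w, hw, fun s r => by rw [hζ, hx, hy, hwζ]; ring⟩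

/-- The sign of `w` can be absorbed in `r`, so it stays available for a second requirement on the
path. -/
theorem phase_neg {q : E → ℝ} {x y : E} {w : ℂ}
    (h : ∀ s r : ℝ, q ((s : ℂ) • x + ((r : ℂ) * w) • y) = 0) (s r : ℝ) :
    q ((s : ℂ) • x + ((r : ℂ) * (-w)) • y) = 0 := by
  simpa using h s (-r)

theorem IsHermitianForm.lineForm {a b : E → ℝ} (ha : IsHermitianForm a) (hb : IsHermitianForm b)
    (α β δ ε : ℝ) : IsHermitianForm (lineForm a b α β δ ε) :=
  ((ha.add (isHermitianForm_norm_sq.const_mul _)).const_mul _).add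
    ((hb.add (isHermitianForm_norm_sq.const_mul _)).const_mul _)

/-- Along a path on which the values of `(a, b)` stay on the line through those at the endpoints,
every point of the segment between these is attained. -/
theorem exists_path_eq_combination {a b : E → ℝ} (ha : IsHermitianForm a)
    (hb : IsHermitianForm b) {x y : E} {w : ℂ} (hw : ‖w‖ = 1) {α₁ β₁ α₂ β₂ : ℝ}
    (hax : a x = α₁ * ‖x‖ ^ 2) (hbx : b x = β₁ * ‖x‖ ^ 2)
    (hay : a y = α₂ * ‖y‖ ^ 2) (hby : b y = β₂ * ‖y‖ ^ 2)
    (hL : ∀ s : ℝ, lineForm a b α₁ β₁ (α₂ - α₁) (β₂ - β₁) (path x y w s) = 0)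
    (hne : ∀ s ∈ Set.Icc (0 : ℝ) 1, path x y w s ≠ 0)
    {τ : ℝ} (hτ : τ ∈ Set.Icc (0 : ℝ) 1) :
    ∃ s ∈ Set.Icc (0 : ℝ) 1,
      a (path x y w s) = (α₁ + τ * (α₂ - α₁)) * ‖path x y w s‖ ^ 2 ∧
      b (path x y w s) = (β₁ + τ * (β₂ - β₁)) * ‖path x y w s‖ ^ 2 := by
  set D := (α₂ - α₁) ^ 2 + (β₂ - β₁) ^ 2 with hD
  rcases eq_or_ne D 0 with h0 | h0
  · have h1 : α₂ - α₁ = 0 := by nlinarith [sq_nonneg (α₂ - α₁), sq_nonneg (β₂ - β₁)]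
    have h2 : β₂ - β₁ = 0 := by nlinarith [sq_nonneg (α₂ - α₁), sq_nonneg (β₂ - β₁)]
    refine ⟨1, by simp, ?_⟩
    rw [path_one, h1, h2, hax, hbx]
    simp
  have hN : ∀ v : E, v ≠ 0 → ‖v‖ ^ 2 ≠ 0 := fun v hv => by simpa using hv
  -- The component of the normalized value along the segment direction, scaled to run from `D` at `s
  -- = 0` to 0 at `s = 1`.
  let f : ℝ → ℝ := fun s => ((α₂ - α₁) * (a (path x y w s) - α₁ * ‖path x y w s‖ ^ 2) +
    (β₂ - β₁) * (b (path x y w s) - β₁ * ‖path x y w s‖ ^ 2)) / ‖path x y w s‖ ^ 2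
  have hNc := isHermitianForm_norm_sq.continuous_path x y w
  have hf : ContinuousOn f (Set.Icc 0 1) := by
    refine ContinuousOn.div ?_ hNc.continuousOn fun s hs => hN _ (hne s hs)
    exact ((((ha.continuous_path x y w).sub (hNc.const_mul α₁)).const_mul _).add
      (((hb.continuous_path x y w).sub (hNc.const_mul β₁)).const_mul _)).continuousOn
  have hf1 : f 1 = 0 := by
    simp only [f, path_one, hax, hbx]
    simp
  have hf0 : f 0 = D := by
    have hN0 := hN _ (hne 0 (by simp))
    simp only [f]
    rw [div_eq_iff hN0, ha.path_zero _ _ hw, hb.path_zero _ _ hw, hay, hby,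
      isHermitianForm_norm_sq.path_zero x y hw]
    ring
  have hDpos : 0 ≤ D := by positivity
  obtain ⟨s, hs, hfs⟩ : τ * D ∈ f '' Set.Icc 0 1 := by
    refine intermediate_value_Icc' zero_le_one hf ⟨?_, ?_⟩
    · rw [hf1]; exact mul_nonneg hτ.1 hDpos
    · rw [hf0]; exact mul_le_of_le_one_left hDpos hτ.2
  have hNs := hN _ (hne s hs)
  have hLs := hL s
  simp only [f] at hfs
  rw [div_eq_iff hNs] at hfs
  simp only [lineForm] at hLs
  -- `hfs` gives the component along the segment and `hLs` the vanishing one across it; this linear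
  -- system has determinant `D` up to sign.
  refine ⟨s, hs, mul_left_cancel₀ h0 ?_, mul_left_cancel₀ h0 ?_⟩
  · linear_combination (α₂ - α₁) * hfs + (β₂ - β₁) * hLs
  · linear_combination (β₂ - β₁) * hfs - (α₂ - α₁) * hLs

/-- The normalized values of `(a, b)` at the nonzero vectors where `c` is nonnegative. -/
def jointRange (a b c : E → ℝ) : Set (ℝ × ℝ) :=
  {p | ∃ x : E, x ≠ 0 ∧ 0 ≤ c x ∧ a x = p.1 * ‖x‖ ^ 2 ∧ b x = p.2 * ‖x‖ ^ 2}

theorem convex_jointRange {a b c : E → ℝ} (ha : IsHermitianForm a) (hb : IsHermitianForm b)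
    (hc : IsHermitianForm c) : Convex ℝ (jointRange a b c) := by
  rw [convex_iff_segment_subset]
  rintro ⟨α₁, β₁⟩ ⟨x, hx, hcx, hax, hbx⟩ ⟨α₂, β₂⟩ ⟨y, hy, hcy, hay, hby⟩
  rw [segment_eq_image']
  rintro _ ⟨τ, hτ, rfl⟩
  by_cases heq : α₁ = α₂ ∧ β₁ = β₂
  · obtain ⟨rfl, rfl⟩ := heq
    exact ⟨x, hx, hcx, by simpa using hax, by simpa using hbx⟩
  obtain ⟨w, hw, hL, hcw⟩ : ∃ w : ℂ, ‖w‖ = 1 ∧ (∀ s r : ℝ,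
      lineForm a b α₁ β₁ (α₂ - α₁) (β₂ - β₁) ((s : ℂ) • x + ((r : ℂ) * w) • y) = 0) ∧
      ∀ s ∈ Set.Icc (0 : ℝ) 1, 0 ≤ c (path x y w s) := by
    obtain ⟨w, hw, hL⟩ := (ha.lineForm hb α₁ β₁ (α₂ - α₁) (β₂ - β₁)).exists_phase
      (lineForm_left hax hbx _ _) (lineForm_right hay hby)
    obtain ⟨ζ, hζ⟩ := hc x y
    -- On the path all three terms in the expansion of `c` are nonnegative once the cross term is.
    have key : ∀ w : ℂ, 0 ≤ (w * ζ).re → ∀ s ∈ Set.Icc (0 : ℝ) 1, 0 ≤ c (path x y w s) := by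
      intro w hw s hs
      have h1 : 0 ≤ 1 - s := by linarith [hs.2]
      have h0 := hs.1
      rw [path, hζ]
      positivity
    rcases le_total 0 (w * ζ).re with h | h
    · exact ⟨w, hw, hL, key w h⟩
    · exact ⟨-w, by simpa using hw, phase_neg hL, key (-w) (by simpa using h)⟩
  -- A zero on the path would make `x` and `y` proportional, hence their normalized values equal,
  -- contrary to `heq`.
  have hne : ∀ s ∈ Set.Icc (0 : ℝ) 1, path x y w s ≠ 0 := by
    intro s hs h0
    have hsx : (s : ℂ) • x = (-(((1 - s : ℝ) : ℂ) * w)) • y := by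
      rw [neg_smul]; exact eq_neg_of_add_eq_zero_left h0
    have hq : ∀ q : E → ℝ, IsHermitianForm q → s ^ 2 * q x = (1 - s) ^ 2 * q y := by
      intro q hq
      rw [← hq.real_smul, hsx, hq.smul, norm_neg, norm_mul, hw, mul_one, norm_real,
        Real.norm_eq_abs, sq_abs]
    have h1 := hq _ isHermitianForm_norm_sq
    have h2 := hq _ ha
    have h3 := hq _ hb
    rw [hax, hay] at h2
    rw [hbx, hby] at h3
    have hs0 : s ≠ 0 := by
      rintro rfl
      simp [hy, eq_comm] at h1
    have hnx : s ^ 2 * ‖x‖ ^ 2 ≠ 0 := by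
      have := norm_ne_zero_iff.2 hx
      positivity
    refine heq ⟨mul_left_cancel₀ hnx ?_, mul_left_cancel₀ hnx ?_⟩
    · linear_combination h2 - α₂ * h1
    · linear_combination h3 - β₂ * h1
  obtain ⟨s, hs, h1, h2⟩ := exists_path_eq_combination ha hb hw hax hbx hay hby
    (fun s => hL s (1 - s)) hne hτ
  exact ⟨_, hne s hs, hcw s hs, by simpa using h1, by simpa using h2⟩

/-! ### Paths outside a kernel and the numerical range -/

/-- If the two paths vanish at `s` and `t`, eliminating `u` gives `t (1 - s) + s (1 - t) = 0`. Then
`s = 0` or `t = 1`, but at these ends the paths equal `w • v` and `u`. -/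
theorem path_ne_zero_or {u v : E} (hu : u ≠ 0) (hv : v ≠ 0) {w : ℂ} (hw : w ≠ 0) :
    (∀ s ∈ Set.Icc (0 : ℝ) 1, path u v w s ≠ 0) ∨
      ∀ s ∈ Set.Icc (0 : ℝ) 1, path u v (-w) s ≠ 0 := by
  by_contra! h
  obtain ⟨⟨s, hs, h1⟩, t, ht, h2⟩ := h
  simp only [path] at h1 h2
  have h3 : ((t * (1 - s) + s * (1 - t) : ℝ) : ℂ) • w • v = 0 := by
    have := congrArg₂ (fun p q => (t : ℂ) • p - (s : ℂ) • q) h1 h2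
    simp only [smul_zero, sub_zero] at this
    rw [← this]
    push_cast
    module
  have hwv : w • v ≠ 0 := smul_ne_zero hw hv
  have h4 : t * (1 - s) + s * (1 - t) = 0 := by
    rcases smul_eq_zero.1 h3 with h | h
    · exact_mod_cast h
    · exact absurd h hwv
  have h5 : 0 ≤ t * (1 - s) := mul_nonneg ht.1 (by linarith [hs.2])
  have h6 : 0 ≤ s * (1 - t) := mul_nonneg hs.1 (by linarith [ht.2])
  have h7 : s * (1 - t) = 0 := by linarith
  rcases mul_eq_zero.1 h7 with h | h
  · subst h
    simp [hw, hv] at h1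
  · have : t = 1 := by linarith
    subst this
    simp [hu] at h2

theorem map_path (T : E →ₗ[ℂ] E) (x y : E) (w : ℂ) (s : ℝ) :
    T (path x y w s) = path (T x) (T y) w s := by
  simp [path]

/-- Two zeros of a Hermitian form outside the kernel of `T` are joined by a path of such zeros. -/
theorem IsHermitianForm.exists_phase_map_ne_zero {q : E → ℝ} (hq : IsHermitianForm q)
    (T : E →ₗ[ℂ] E) {x y : E} (hx : q x = 0) (hy : q y = 0) (hTx : T x ≠ 0) (hTy : T y ≠ 0) :
    ∃ w : ℂ, ‖w‖ = 1 ∧ (∀ s : ℝ, q (path x y w s) = 0) ∧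
      ∀ s ∈ Set.Icc (0 : ℝ) 1, T (path x y w s) ≠ 0 := by
  obtain ⟨w, hw, hL⟩ := hq.exists_phase hx hy
  simp only [map_path]
  rcases path_ne_zero_or hTx hTy (w := w) (by rintro rfl; simp at hw) with h | h
  · exact ⟨w, hw, fun s => hL s (1 - s), h⟩
  · exact ⟨-w, by simpa using hw, fun s => phase_neg hL s (1 - s), h⟩

/-- The part of the numerical range of `T` that comes from vectors outside the kernel of `T`. -/
def numRange (T : E →ₗ[ℂ] E) : Set ℂ :=
  {z | ∃ x : E, T x ≠ 0 ∧ inner ℂ x (T x) = z * ((‖x‖ ^ 2 : ℝ) : ℂ)}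

theorem convex_numRange (T : E →ₗ[ℂ] E) : Convex ℝ (numRange T) := by
  rw [convex_iff_segment_subset]
  rintro z₁ ⟨x, hTx, hx⟩ z₂ ⟨y, hTy, hy⟩
  rw [segment_eq_image']
  rintro _ ⟨τ, hτ, rfl⟩
  have ha := isHermitianForm_re T
  have hb := isHermitianForm_im T
  have hax : (inner ℂ x (T x)).re = z₁.re * ‖x‖ ^ 2 := by rw [hx, re_mul_ofReal]
  have hbx : (inner ℂ x (T x)).im = z₁.im * ‖x‖ ^ 2 := by rw [hx, im_mul_ofReal]
  have hay : (inner ℂ y (T y)).re = z₂.re * ‖y‖ ^ 2 := by rw [hy, re_mul_ofReal]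
  have hby : (inner ℂ y (T y)).im = z₂.im * ‖y‖ ^ 2 := by rw [hy, im_mul_ofReal]
  obtain ⟨w, hw, hL, hne⟩ := (ha.lineForm hb z₁.re z₁.im
    (z₂.re - z₁.re) (z₂.im - z₁.im)).exists_phase_map_ne_zero T
    (lineForm_left hax hbx _ _) (lineForm_right hay hby) hTx hTy
  obtain ⟨s, hs, h1, h2⟩ := exists_path_eq_combination ha hb hw hax hbx hay hby hL
    (fun s hs h => hne s hs (by rw [h, map_zero])) hτ
  refine ⟨_, hne s hs, Complex.ext ?_ ?_⟩
  · rw [re_mul_ofReal]; simpa using h1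
  · rw [im_mul_ofReal]; simpa using h2

end HermitianForm

/-! ### The normalized numerical range and the radar -/

section Radar

variable {n : ℕ}

theorem mem_gph {A : Matrix (Fin n) (Fin n) ℂ} {x y : EuclideanSpace ℂ (Fin n)} :
    (x, y) ∈ gph A ↔ y = Matrix.toEuclideanLin A x := Iff.rfl

theorem mem_nnr {A : Matrix (Fin n) (Fin n) ℂ} {z : ℂ} :
    z ∈ nnr A ↔ ∃ x, Matrix.toEuclideanLin A x ≠ 0 ∧
      z = inner ℂ x (Matrix.toEuclideanLin A x) /
        ((‖x‖ * ‖Matrix.toEuclideanLin A x‖ : ℝ) : ℂ) := by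
  constructor
  · rintro ⟨x, y, hy, hne, hz⟩
    obtain rfl := mem_gph.1 hy
    exact ⟨x, hne, hz⟩
  · rintro ⟨x, hne, hz⟩
    exact ⟨x, _, mem_gph.2 rfl, hne, hz⟩

theorem norm_pos_of_map_ne_zero {E : Type*} [NormedAddCommGroup E] [InnerProductSpace ℂ E]
    {T : E →ₗ[ℂ] E} {x : E} (h : T x ≠ 0) : 0 < ‖x‖ :=
  norm_pos_iff.2 fun h0 => h (by rw [h0, map_zero])

/-- A vector `x` contributes to the line of angle `θ` exactly when the Hermitian form `Im ⟨x, e⁻¹ T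
x⟩` vanishes. Zeros of this form outside the kernel are joined, up to phase, by paths of such zeros,
along which the radius is continuous. -/
theorem ordConnected_radius_nnr (A : Matrix (Fin n) (Fin n) ℂ) (θ : ℝ) :
    {r : ℝ | (r : ℂ) * exp (I * (θ : ℂ)) ∈ nnr A}.OrdConnected := by
  set T := Matrix.toEuclideanLin A with hT
  have hexp : exp (I * (θ : ℂ)) ≠ 0 := exp_ne_zero _
  set e := exp (I * (θ : ℂ)) with he
  have hmem : ∀ r : ℝ, (r : ℂ) * e ∈ nnr A ↔ ∃ x, T x ≠ 0 ∧
      (inner ℂ x ((e⁻¹ • T) x)).im = 0 ∧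
      r = (inner ℂ x ((e⁻¹ • T) x)).re / (‖x‖ * ‖T x‖) := by
    intro r
    rw [mem_nnr]
    refine exists_congr fun x => and_congr_right fun hx => ?_
    have hpos : ‖x‖ * ‖T x‖ ≠ 0 :=
      (mul_pos (norm_pos_of_map_ne_zero hx) (norm_pos_iff.2 hx)).ne'
    have hpos' : ((‖x‖ * ‖T x‖ : ℝ) : ℂ) ≠ 0 := ofReal_ne_zero.2 hpos
    have h1 : (r : ℂ) * e = inner ℂ x (T x) / ((‖x‖ * ‖T x‖ : ℝ) : ℂ) ↔
        inner ℂ x ((e⁻¹ • T) x) = ((r * (‖x‖ * ‖T x‖) : ℝ) : ℂ) := by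
      rw [LinearMap.smul_apply, inner_smul_right, eq_div_iff hpos', inv_mul_eq_iff_eq_mul₀ hexp,
        ofReal_mul r, eq_comm, mul_left_comm, mul_assoc]
    rw [h1, Complex.ext_iff, ofReal_re, ofReal_im, eq_div_iff hpos, and_comm, eq_comm (a := r * _)]
  rw [Set.ordConnected_iff_uIcc_subset]
  intro r₁ h₁ r₂ h₂ r hr
  rw [Set.mem_ofPred_eq, hmem] at h₁ h₂ ⊢
  obtain ⟨x, hx, hqx, rfl⟩ := h₁
  obtain ⟨y, hy, hqy, rfl⟩ := h₂
  have hp := isHermitianForm_re (e⁻¹ • T)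
  obtain ⟨w, hw, hq, hne⟩ :=
    (isHermitianForm_im (e⁻¹ • T)).exists_phase_map_ne_zero T hqx hqy hx hy
  let f : ℝ → ℝ := fun s => (inner ℂ (path x y w s) ((e⁻¹ • T) (path x y w s))).re /
    (‖path x y w s‖ * ‖T (path x y w s)‖)
  have hf : ContinuousOn f (Set.uIcc 0 1) := by
    rw [Set.uIcc_of_le zero_le_one]
    refine (hp.continuous_path x y w).continuousOn.div ?_ fun s hs => ?_
    · simp only [path]
      exact Continuous.continuousOn (by fun_prop)
    · exact (mul_pos (norm_pos_of_map_ne_zero (hne s hs)) (norm_pos_iff.2 (hne s hs))).ne'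
  have hf0 : f 0 = (inner ℂ y ((e⁻¹ • T) y)).re / (‖y‖ * ‖T y‖) := by
    have h := hp.path_zero x y hw
    have hN : ‖path x y w 0‖ = ‖y‖ := by simp [path, norm_smul, hw]
    have hTN : ‖T (path x y w 0)‖ = ‖T y‖ := by simp [path, norm_smul, hw]
    exact congrArg₂ (· / ·) h (by rw [hN, hTN])
  have hf1 : f 1 = (inner ℂ x ((e⁻¹ • T) x)).re / (‖x‖ * ‖T x‖) := by
    simp only [f, path_one]
  rw [← hf0, ← hf1, Set.uIcc_comm] at hr
  obtain ⟨s, hs, rfl⟩ := intermediate_value_uIcc hf hr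
  rw [Set.uIcc_of_le zero_le_one] at hs
  exact ⟨_, hne s hs, hq s, rfl⟩

theorem isPreconnected_radar_inter_nnr (A : Matrix (Fin n) (Fin n) ℂ) (θ : ℝ) :
    IsPreconnected (radar θ ∩ nnr A) := by
  have h : radar θ ∩ nnr A = (fun r : ℝ => (r : ℂ) * exp (I * (θ : ℂ))) ''
      {r : ℝ | (r : ℂ) * exp (I * (θ : ℂ)) ∈ nnr A} := by
    ext z
    constructor
    · rintro ⟨⟨r, rfl⟩, hz⟩
      exact ⟨r, hz, rfl⟩
    · rintro ⟨r, hr, rfl⟩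
      exact ⟨⟨r, rfl⟩, hr⟩
  rw [h]
  exact (ordConnected_radius_nnr A θ).isPreconnected.image _
    (Continuous.continuousOn (by fun_prop))

/-- At a given `x` the two ranges differ by a real factor, so they meet the same lines through 0. -/
theorem exists_real_mul_mem_nnr {A : Matrix (Fin n) (Fin n) ℂ} {z : ℂ}
    (hz : z ∈ numRange (Matrix.toEuclideanLin A)) : ∃ k : ℝ, (k : ℂ) * z ∈ nnr A := by
  obtain ⟨x, hx, h⟩ := hz
  refine ⟨‖x‖ ^ 2 / (‖x‖ * ‖Matrix.toEuclideanLin A x‖), mem_nnr.2 ⟨x, hx, ?_⟩⟩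
  rw [h, ofReal_div]
  ring

theorem exists_eq_real_mul_of_mem_nnr {A : Matrix (Fin n) (Fin n) ℂ} {u : ℂ} (hu : u ∈ nnr A) :
    ∃ z ∈ numRange (Matrix.toEuclideanLin A), ∃ k : ℝ, u = k * z := by
  obtain ⟨x, hx, rfl⟩ := mem_nnr.1 hu
  have h0 : ((‖x‖ ^ 2 : ℝ) : ℂ) ≠ 0 :=
    ofReal_ne_zero.2 (pow_pos (norm_pos_of_map_ne_zero hx) 2).ne'
  refine ⟨inner ℂ x (Matrix.toEuclideanLin A x) / ((‖x‖ ^ 2 : ℝ) : ℂ),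
    ⟨x, hx, (div_mul_cancel₀ _ h0).symm⟩,
    ‖x‖ ^ 2 / (‖x‖ * ‖Matrix.toEuclideanLin A x‖), ?_⟩
  rw [ofReal_div]
  field_simp

theorem mem_radar_arg (z : ℂ) : z ∈ radar (arg z) :=
  ⟨‖z‖, by rw [mul_comm I, norm_mul_exp_arg_mul_I]⟩

theorem real_mul_mem_radar {z : ℂ} {θ : ℝ} (h : z ∈ radar θ) (k : ℝ) : (k : ℂ) * z ∈ radar θ := by
  obtain ⟨r, rfl⟩ := h
  exact ⟨k * r, by push_cast; ring⟩

theorem mul_mem_radar {z u : ℂ} {θ η : ℝ} (hz : z ∈ radar θ) (hu : u ∈ radar η) :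
    z * u ∈ radar (θ + η) := by
  obtain ⟨r, rfl⟩ := hz
  obtain ⟨t, rfl⟩ := hu
  refine ⟨r * t, ?_⟩
  push_cast
  rw [mul_add, exp_add]
  ring

/-- If `z = -k z₀` with `k ≥ 0`, then `0 = (z + k z₀) / (1 + k)` would be a convex combination of
points of `W`. -/
theorem _root_.Convex.div_mem_slitPlane {W : Set ℂ} (hW : Convex ℝ W) (h0 : (0 : ℂ) ∉ W)
    {z₀ z : ℂ} (hz₀ : z₀ ∈ W) (hz : z ∈ W) : z / z₀ ∈ slitPlane := by
  have hne : z₀ ≠ 0 := fun h => h0 (h ▸ hz₀)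
  by_contra h
  rw [mem_slitPlane_iff] at h
  push Not at h
  obtain ⟨hre, him⟩ := h
  set k := -(z / z₀).re with hk
  have hk0 : 0 ≤ k := by linarith
  have hzk : z = -(k : ℂ) * z₀ := by
    rw [← div_eq_iff hne]
    apply Complex.ext <;> simp [hk, him]
  refine h0 ?_
  have hk1 : (1 : ℝ) + k ≠ 0 := by positivity
  have := hW hz hz₀ (a := 1 / (1 + k)) (b := k / (1 + k)) (by positivity) (by positivity)
    (by field_simp)
  convert this using 1
  rw [hzk, real_smul, real_smul]
  push_cast
  ring

theorem hasTexture_radar_nnr (A : Matrix (Fin n) (Fin n) ℂ) : HasTexture radar (nnr A) := by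
  -- If 0 is attained, every line meets the set and all angles may be used.
  by_cases h0 : (0 : ℂ) ∈ nnr A
  · refine ⟨Set.univ, Set.ordConnected_univ, fun z _ => ?_, fun θ _ =>
      ⟨⟨0, ⟨0, by simp⟩, h0⟩, isPreconnected_radar_inter_nnr A θ⟩⟩
    simp only [Set.mem_iUnion]
    exact ⟨arg z, Set.mem_univ _, mem_radar_arg z⟩
  set W := numRange (Matrix.toEuclideanLin A) with hW
  have hconv : Convex ℝ W := convex_numRange _
  have h0W : (0 : ℂ) ∉ W := fun h => by
    obtain ⟨k, hk⟩ := exists_real_mul_mem_nnr h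
    exact h0 (by simpa using hk)
  rcases W.eq_empty_or_nonempty with hE | ⟨z₀, hz₀⟩
  · refine ⟨∅, Set.ordConnected_empty, fun u hu => ?_, by simp⟩
    obtain ⟨z, hz, -⟩ := exists_eq_real_mul_of_mem_nnr hu
    rw [← hW, hE] at hz
    exact hz.elim
  have hne : z₀ ≠ 0 := fun h => h0W (h ▸ hz₀)
  have hradar : ∀ z, z ∈ radar (arg z₀ + arg (z / z₀)) := fun z => by
    simpa [mul_div_cancel₀ z hne] using mul_mem_radar (mem_radar_arg z₀) (mem_radar_arg (z / z₀))
  -- Measuring angles from `z₀` keeps `W` off the branch cut of `arg`.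
  refine ⟨(fun z => arg z₀ + arg (z / z₀)) '' W, ?_, fun u hu => ?_, ?_⟩
  · refine (hconv.isPreconnected.image _ (continuousOn_const.add ?_)).ordConnected
    intro z hz
    exact ((continuousAt_arg (hconv.div_mem_slitPlane h0W hz₀ hz)).comp
      (f := fun z => z / z₀) (by fun_prop)).continuousWithinAt
  · obtain ⟨z, hz, k, rfl⟩ := exists_eq_real_mul_of_mem_nnr hu
    simp only [Set.mem_iUnion]
    exact ⟨_, ⟨z, hz, rfl⟩, real_mul_mem_radar (hradar z) k⟩
  · rintro _ ⟨z, hz, rfl⟩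
    obtain ⟨k, hk⟩ := exists_real_mul_mem_nnr hz
    exact ⟨⟨_, real_mul_mem_radar (hradar z) k, hk⟩, isPreconnected_radar_inter_nnr A _⟩

end Radar

/-! ### Scaled relative graphs, gratings and ripples -/

section Gain

variable {n : ℕ}

/-- A set parametrized by a convex set such that the curves of `T` are the level sets of `h` and
have convex preimages has texture `T`. -/
theorem hasTexture_image {T : ℝ → Set ℂ} {Q : Set (ℝ × ℝ)} (hQ : Convex ℝ Q)
    {g : ℝ × ℝ → ℂ} (hg : Continuous g) {h : ℝ × ℝ → ℝ} (hh : Continuous h)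
    (hT : ∀ p ∈ Q, ∀ ξ, g p ∈ T ξ ↔ h p = ξ) (hlevel : ∀ ξ, Convex ℝ {p ∈ Q | h p = ξ}) :
    HasTexture T (g '' Q) := by
  refine ⟨h '' Q, (hQ.isPreconnected.image h hh.continuousOn).ordConnected, ?_, ?_⟩
  · rintro _ ⟨p, hp, rfl⟩
    simp only [Set.mem_iUnion]
    exact ⟨h p, ⟨p, hp, rfl⟩, (hT p hp _).2 rfl⟩
  · rintro _ ⟨p, hp, rfl⟩
    refine ⟨⟨g p, (hT p hp _).2 rfl, p, hp, rfl⟩, ?_⟩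
    have : T (h p) ∩ g '' Q = g '' {q ∈ Q | h q = h p} := by
      ext z
      constructor
      · rintro ⟨hz, q, hq, rfl⟩
        exact ⟨q, ⟨hq, (hT q hq _).1 hz⟩, rfl⟩
      · rintro ⟨q, ⟨hq, hqp⟩, rfl⟩
        exact ⟨(hT q hq _).2 hqp, q, hq, rfl⟩
    rw [this]
    exact (hlevel _).isPreconnected.image g hg.continuousOn

/-- The point with real part `p.1` and squared modulus `p.2` in the half plane of sign `σ`. -/
noncomputable def arcPoint (σ : ℝ) (p : ℝ × ℝ) : ℂ := ⟨p.1, σ * √(p.2 - p.1 ^ 2)⟩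

theorem continuous_arcPoint (σ : ℝ) : Continuous (arcPoint σ) := by
  have h : arcPoint σ = fun p => (p.1 : ℂ) + ((σ * √(p.2 - p.1 ^ 2) : ℝ) : ℂ) * I := by
    funext p
    apply Complex.ext <;> simp [arcPoint]
  rw [h]
  fun_prop

theorem convex_level {Q : Set (ℝ × ℝ)} (hQ : Convex ℝ Q) (k l m : ℝ) :
    Convex ℝ {p ∈ Q | k * p.1 + l * p.2 = m} := by
  refine hQ.inter ?_
  rintro ⟨p, q⟩ hp ⟨p', q'⟩ hp' a b - - hab
  change k * p + l * q = m at hp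
  change k * p' + l * q' = m at hp'
  change k * (a * p + b * p') + l * (a * q + b * q') = m
  linear_combination a * hp + b * hp' + m * hab

/-- For real `c` the square root enters only through its square, so the squared distance is affine
in `p`. -/
theorem norm_arcPoint_sub_sq {σ : ℝ} (hσ : σ ^ 2 = 1) {p : ℝ × ℝ} (hp : p.1 ^ 2 ≤ p.2) (c : ℝ) :
    ‖arcPoint σ p - c‖ ^ 2 = p.2 - 2 * c * p.1 + c ^ 2 := by
  rw [← normSq_eq_norm_sq, normSq_apply]
  simp only [arcPoint, sub_re, sub_im, ofReal_re, ofReal_im, sub_zero]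
  have h := Real.sq_sqrt (sub_nonneg.2 hp)
  linear_combination √(p.2 - p.1 ^ 2) ^ 2 * hσ + h

theorem norm_arcPoint_sub {σ : ℝ} (hσ : σ ^ 2 = 1) {p : ℝ × ℝ} (hp : p.1 ^ 2 ≤ p.2) (c : ℝ) :
    ‖arcPoint σ p - c‖ = √(p.2 - 2 * c * p.1 + c ^ 2) := by
  rw [← norm_arcPoint_sub_sq hσ hp, Real.sqrt_sq (norm_nonneg _)]

/-- Undoing the rotation by `θ` makes the lines vertical and the offset direction the positive real
axis. -/
theorem mem_grating_sub_pi_div_two {θ k : ℝ} {z : ℂ} :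
    exp (I * (θ : ℂ)) * z ∈ grating (θ - Real.pi / 2) k ↔ z.re = k := by
  have h : ∀ r : ℝ, (r : ℂ) * exp (I * ((θ - Real.pi / 2 : ℝ) : ℂ)) +
      (k : ℂ) * exp (I * ((θ - Real.pi / 2 + Real.pi / 2 : ℝ) : ℂ)) =
      exp (I * (θ : ℂ)) * ⟨k, -r⟩ := by
    intro r
    have h1 : exp (I * ((θ - Real.pi / 2 : ℝ) : ℂ)) = exp (I * (θ : ℂ)) * (-I) := by
      rw [← exp_neg_pi_div_two_mul_I, ← exp_add]
      congr 1
      push_cast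
      ring
    have h2 : (⟨k, -r⟩ : ℂ) = (k : ℂ) + ((-r : ℝ) : ℂ) * I := by
      apply Complex.ext <;> simp
    rw [h1, sub_add_cancel, h2]
    push_cast
    ring
  simp only [grating, Set.mem_ofPred_eq, h]
  constructor
  · rintro ⟨r, hr⟩
    rw [mul_left_cancel₀ (exp_ne_zero _) hr]
  · rintro rfl
    exact ⟨-z.im, by rw [neg_neg]⟩

theorem norm_exp_I_mul (θ : ℝ) : ‖exp (I * (θ : ℂ))‖ = 1 := by
  rw [mul_comm, norm_exp_ofReal_mul_I]

theorem hasTexture_grating_rotate_arcPoint {Q : Set (ℝ × ℝ)} (hQ : Convex ℝ Q) (σ θ : ℝ) :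
    HasTexture (grating (θ - Real.pi / 2)) (rotate θ (arcPoint σ '' Q)) := by
  rw [rotate, Set.image_image]
  refine hasTexture_image hQ (continuous_const.mul (continuous_arcPoint σ)) continuous_fst
    (fun p _ ξ => mem_grating_sub_pi_div_two) fun ξ => ?_
  simpa using convex_level hQ 1 0 ξ

theorem hasTexture_grating_arcPoint {Q : Set (ℝ × ℝ)} (hQ : Convex ℝ Q) (σ : ℝ) :
    HasTexture (grating (Real.pi / 2)) (arcPoint σ '' Q) := by
  refine hasTexture_image hQ (continuous_arcPoint σ) continuous_fst.neg (fun p _ ξ => ?_)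
    fun ξ => ?_
  -- For `φ = π / 2` the offset points in direction `π`, so the parameter is minus the real part.
  · have h := mem_grating_sub_pi_div_two (θ := Real.pi) (k := ξ) (z := -arcPoint σ p)
    rw [mul_comm I, exp_pi_mul_I, neg_one_mul, neg_neg,
      show Real.pi - Real.pi / 2 = Real.pi / 2 by ring] at h
    simpa [arcPoint] using h
  · simpa using convex_level hQ (-1) 0 ξ

theorem hasTexture_ripple_rotate_arcPoint {Q : Set (ℝ × ℝ)} (hQ : Convex ℝ Q)
    (hQ' : ∀ p ∈ Q, p.1 ^ 2 ≤ p.2) {σ : ℝ} (hσ : σ ^ 2 = 1) (θ c : ℝ) :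
    HasTexture (ripple ((c : ℂ) * exp (I * (θ : ℂ)))) (rotate θ (arcPoint σ '' Q)) := by
  rw [rotate, Set.image_image]
  refine hasTexture_image hQ (continuous_const.mul (continuous_arcPoint σ))
    (h := fun p => √(p.2 - 2 * c * p.1 + c ^ 2)) (by fun_prop) (fun p hp ξ => ?_) fun ξ => ?_
  · rw [ripple, Set.mem_ofPred_eq, mul_comm (c : ℂ), ← mul_sub, norm_mul, norm_exp_I_mul, one_mul,
      norm_arcPoint_sub hσ (hQ' p hp)]
  -- Negative radii give empty level sets; otherwise squaring leaves a linear equation in `p`.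
  · rcases lt_or_ge ξ 0 with hξ | hξ
    · convert convex_empty
      refine Set.eq_empty_of_forall_notMem fun p hp => ?_
      have h1 := hp.2
      have h2 := Real.sqrt_nonneg (p.2 - 2 * c * p.1 + c ^ 2)
      linarith
    · convert convex_level hQ (-(2 * c)) 1 (ξ ^ 2 - c ^ 2) using 3 with p
      refine and_congr_right fun hp => ?_
      have h0 : 0 ≤ p.2 - 2 * c * p.1 + c ^ 2 := by
        rw [← norm_arcPoint_sub_sq hσ (hQ' p hp)]
        positivity
      rw [Real.sqrt_eq_iff_eq_sq h0 hξ]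
      constructor <;> intro h <;> linarith

theorem rotate_zero (S : Set ℂ) : rotate 0 S = S := by
  simp [rotate]

theorem hasTexture_ripple_arcPoint {Q : Set (ℝ × ℝ)} (hQ : Convex ℝ Q)
    (hQ' : ∀ p ∈ Q, p.1 ^ 2 ≤ p.2) {σ : ℝ} (hσ : σ ^ 2 = 1) (c : ℝ) :
    HasTexture (ripple (c : ℂ)) (arcPoint σ '' Q) := by
  simpa [rotate_zero] using hasTexture_ripple_rotate_arcPoint hQ hQ' hσ 0 c

/-- The point of a scaled relative graph given by the pair `(x, y)` and the sign `s`. -/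
noncomputable def graphPoint (x y : EuclideanSpace ℂ (Fin n)) (s : ℝ) : ℂ :=
  ((‖y‖ / ‖x‖ : ℝ) : ℂ) * exp (I * ((s * pairAngle x y : ℝ) : ℂ))

/-- Cauchy–Schwarz puts the argument of `arccos` in `[-1, 1]`; the sign `s` then affects only the
sine. -/
theorem graphPoint_eq_arcPoint {x y : EuclideanSpace ℂ (Fin n)} (hx : x ≠ 0) (hy : y ≠ 0)
    {s : ℝ} (hs : s = 1 ∨ s = -1) :
    graphPoint x y s = arcPoint s ((inner ℂ x y).re / ‖x‖ ^ 2, ‖y‖ ^ 2 / ‖x‖ ^ 2) := by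
  have hx' : 0 < ‖x‖ := norm_pos_iff.2 hx
  have hy' : 0 < ‖y‖ := norm_pos_iff.2 hy
  have habs : |(inner ℂ x y).re / (‖x‖ * ‖y‖)| ≤ 1 := by
    rw [abs_div, abs_of_pos (mul_pos hx' hy'), div_le_one (mul_pos hx' hy')]
    exact (abs_re_le_norm _).trans (norm_inner_le_norm x y)
  obtain ⟨h1, h2⟩ := abs_le.1 habs
  have hcos : Real.cos (s * pairAngle x y) = (inner ℂ x y).re / (‖x‖ * ‖y‖) := by
    rcases hs with rfl | rfl <;> simp [pairAngle, Real.cos_arccos h1 h2]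
  have hsin : Real.sin (s * pairAngle x y) =
      s * √(1 - ((inner ℂ x y).re / (‖x‖ * ‖y‖)) ^ 2) := by
    rcases hs with rfl | rfl <;> simp [pairAngle, Real.sin_arccos]
  rw [graphPoint, mul_comm I, exp_mul_I, ← ofReal_cos, ← ofReal_sin, hcos, hsin]
  apply Complex.ext
  · simp only [arcPoint, add_re, ofReal_re, mul_re, I_re, I_im, ofReal_im]
    field_simp
    ring
  · simp only [arcPoint, add_im, ofReal_re, mul_im, I_re, I_im, ofReal_im]
    have : √(‖y‖ ^ 2 / ‖x‖ ^ 2 - ((inner ℂ x y).re / ‖x‖ ^ 2) ^ 2) =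
        ‖y‖ / ‖x‖ * √(1 - ((inner ℂ x y).re / (‖x‖ * ‖y‖)) ^ 2) := by
      rw [← Real.sqrt_sq (div_pos hy' hx').le, ← Real.sqrt_mul (sq_nonneg _)]
      congr 1
      field_simp
    rw [this]
    ring

/-- The values of the scaled relative graph of `A` whose sign agrees with that of `c x`. -/
def signedGraph (A : Matrix (Fin n) (Fin n) ℂ) (c : EuclideanSpace ℂ (Fin n) → ℝ) : Set ℂ :=
  {z | ∃ x, Matrix.toEuclideanLin A x ≠ 0 ∧ ∃ s : ℝ, (s = 1 ∨ s = -1) ∧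
    (0 < c x → s = 1) ∧ (c x < 0 → s = -1) ∧ z = graphPoint x (Matrix.toEuclideanLin A x) s}

/-- With `c = 0` the sign is unconstrained, so one argument serves both kinds of graph. -/
theorem srg_eq_signedGraph (A : Matrix (Fin n) (Fin n) ℂ) : srg A = signedGraph A 0 := by
  ext z
  constructor
  · rintro ⟨x, y, hy, hne, s, hs, hz⟩
    obtain rfl := mem_gph.1 hy
    exact ⟨x, hne, s, hs, by simp, by simp, hz⟩
  · rintro ⟨x, hne, s, hs, -, -, hz⟩
    exact ⟨x, _, mem_gph.2 rfl, hne, s, hs, hz⟩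

theorem ssg_eq_signedGraph (A : Matrix (Fin n) (Fin n) ℂ) :
    ssg A = signedGraph A fun x => (inner ℂ x (Matrix.toEuclideanLin A x)).im := by
  ext z
  constructor
  · rintro ⟨x, y, hy, hne, s, hs, h1, h2, hz⟩
    obtain rfl := mem_gph.1 hy
    exact ⟨x, hne, s, hs, h1, h2, hz⟩
  · rintro ⟨x, hne, s, hs, h1, h2, hz⟩
    exact ⟨x, _, mem_gph.2 rfl, hne, s, hs, h1, h2, hz⟩

/-- The function `c` vanishes at the vectors whose image under `A` is a real multiple. -/
def VanishesOnCollinear (A : Matrix (Fin n) (Fin n) ℂ) (c : EuclideanSpace ℂ (Fin n) → ℝ) :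
    Prop :=
  ∀ x, ‖x‖ ^ 2 * ‖Matrix.toEuclideanLin A x‖ ^ 2 ≤
    (inner ℂ x (Matrix.toEuclideanLin A x)).re ^ 2 → c x = 0

theorem re_inner_sq_add_im_inner_sq_le {E : Type*} [NormedAddCommGroup E] [InnerProductSpace ℂ E]
    (x y : E) : (inner ℂ x y).re ^ 2 + (inner ℂ x y).im ^ 2 ≤ ‖x‖ ^ 2 * ‖y‖ ^ 2 := by
  have h := pow_le_pow_left₀ (norm_nonneg _) (norm_inner_le_norm (𝕜 := ℂ) x y) 2
  rw [← normSq_eq_norm_sq, normSq_apply] at h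
  linarith

/-- When the real part already saturates Cauchy–Schwarz, nothing is left for the imaginary part. -/
theorem vanishesOnCollinear_im (A : Matrix (Fin n) (Fin n) ℂ) :
    VanishesOnCollinear A fun x => (inner ℂ x (Matrix.toEuclideanLin A x)).im := by
  intro x hx
  have h := re_inner_sq_add_im_inner_sq_le x (Matrix.toEuclideanLin A x)
  exact pow_eq_zero_iff two_ne_zero |>.1 (le_antisymm (by linarith) (sq_nonneg _))

/-- The pairs `(Re ⟨x, A x⟩, ‖A x‖²) / ‖x‖²` for nonzero `x` with `c x` nonnegative. -/
def gainRange (A : Matrix (Fin n) (Fin n) ℂ) (c : EuclideanSpace ℂ (Fin n) → ℝ) :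
    Set (ℝ × ℝ) :=
  jointRange (fun x => (inner ℂ x (Matrix.toEuclideanLin A x)).re)
    (fun x => ‖Matrix.toEuclideanLin A x‖ ^ 2) c

theorem convex_gainRange (A : Matrix (Fin n) (Fin n) ℂ) {c : EuclideanSpace ℂ (Fin n) → ℝ}
    (hc : IsHermitianForm c) : Convex ℝ (gainRange A c) :=
  convex_jointRange (isHermitianForm_re _) (isHermitianForm_norm_sq_apply _) hc

theorem sq_le_of_mem_gainRange {A : Matrix (Fin n) (Fin n) ℂ}
    {c : EuclideanSpace ℂ (Fin n) → ℝ} {p : ℝ × ℝ} (hp : p ∈ gainRange A c) : p.1 ^ 2 ≤ p.2 := by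
  obtain ⟨x, hx, -, h1, h2⟩ := hp
  have h := re_inner_sq_add_im_inner_sq_le x (Matrix.toEuclideanLin A x)
  have hpos : 0 < (‖x‖ ^ 2) ^ 2 := by
    have := norm_pos_iff.2 hx
    positivity
  simp only at h1 h2
  rw [h1, h2] at h
  refine le_of_mul_le_mul_right ?_ hpos
  nlinarith [sq_nonneg (inner ℂ x (Matrix.toEuclideanLin A x)).im]

/-- A point of the wrong sign lies in the half plane only if it is real; then `c x = 0`, so `x` also
counts for the sign `σ`. The condition `0 < p.2` encodes `A x ≠ 0`. -/
theorem signedGraph_inter_eq_image (A : Matrix (Fin n) (Fin n) ℂ)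
    {c : EuclideanSpace ℂ (Fin n) → ℝ} (hc : VanishesOnCollinear A c) {σ : ℝ}
    (hσ : σ = 1 ∨ σ = -1) :
    signedGraph A c ∩ {z | 0 ≤ σ * z.im} =
      arcPoint σ '' (gainRange A (fun x => σ * c x) ∩ {p | 0 < p.2}) := by
  ext z
  constructor
  · rintro ⟨⟨x, hne, s, hs, hpos, hneg, rfl⟩, him⟩
    have hx : x ≠ 0 := norm_pos_iff.1 (norm_pos_of_map_ne_zero hne)
    have hx' : 0 < ‖x‖ := norm_pos_iff.2 hx
    have hy' : 0 < ‖Matrix.toEuclideanLin A x‖ := norm_pos_iff.2 hne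
    rw [graphPoint_eq_arcPoint hx hne hs] at him ⊢
    have hmem : 0 ≤ σ * c x → ((inner ℂ x (Matrix.toEuclideanLin A x)).re / ‖x‖ ^ 2,
        ‖Matrix.toEuclideanLin A x‖ ^ 2 / ‖x‖ ^ 2) ∈
        gainRange A (fun x => σ * c x) ∩ {p | 0 < p.2} := fun h =>
      ⟨⟨x, hx, h, by field_simp, by field_simp⟩, by simp only [Set.mem_ofPred_eq]; positivity⟩
    by_cases hsσ : s = σ
    · subst hsσ
      refine ⟨_, hmem ?_, rfl⟩
      by_contra! hlt
      rcases hs with rfl | rfl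
      · linarith [hneg (by linarith)]
      · linarith [hpos (by linarith)]
    · have hσs : σ * s = -1 := by
        rcases hs with rfl | rfl <;> rcases hσ with rfl | rfl <;> simp at *
      have h0 : √(‖Matrix.toEuclideanLin A x‖ ^ 2 / ‖x‖ ^ 2 -
          ((inner ℂ x (Matrix.toEuclideanLin A x)).re / ‖x‖ ^ 2) ^ 2) = 0 := by
        refine le_antisymm ?_ (Real.sqrt_nonneg _)
        simp only [arcPoint, Set.mem_ofPred_eq, ← mul_assoc, hσs] at him
        linarith
      have hcx : c x = 0 := by
        refine hc x ?_
        rw [Real.sqrt_eq_zero', sub_nonpos, div_pow, div_le_div_iff₀ (by positivity)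
          (by positivity)] at h0
        refine le_of_mul_le_mul_right ?_ (pow_pos hx' 2)
        linarith
      refine ⟨_, hmem (by rw [hcx, mul_zero]), ?_⟩
      simp only [arcPoint, h0, mul_zero]
  · rintro ⟨⟨α, β⟩, ⟨⟨x, hx, hcx, h1, h2⟩, hβ⟩, rfl⟩
    simp only [Set.mem_ofPred_eq] at hβ h1 h2 hcx
    have hx' : 0 < ‖x‖ := norm_pos_iff.2 hx
    have hne : Matrix.toEuclideanLin A x ≠ 0 := by
      have : 0 < ‖Matrix.toEuclideanLin A x‖ ^ 2 := by rw [h2]; positivity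
      exact fun h => by simp [h] at this
    refine ⟨⟨x, hne, σ, hσ, fun h => ?_, fun h => ?_, ?_⟩, ?_⟩
    · rcases hσ with rfl | rfl
      · rfl
      · linarith
    · rcases hσ with rfl | rfl
      · linarith
      · rfl
    · rw [graphPoint_eq_arcPoint hx hne hσ, h1, h2]
      have : ‖x‖ ^ 2 ≠ 0 := by positivity
      rw [mul_div_cancel_right₀ _ this, mul_div_cancel_right₀ _ this]
    · simp only [Set.mem_ofPred_eq, arcPoint]
      rcases hσ with rfl | rfl <;> simp [Real.sqrt_nonneg]

theorem mem_kernelValue {A : Matrix (Fin n) (Fin n) ℂ} {z : ℂ} :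
    z ∈ kernelValue A ↔ z = 0 ∧ ∃ x, x ≠ 0 ∧ Matrix.toEuclideanLin A x = 0 := by
  simp only [kernelValue, gph, Set.mem_ofPred_eq, eq_comm (a := (0 : EuclideanSpace ℂ (Fin n)))]

/-- Kernel vectors satisfy `c x = 0` and give `p = (0, 0)`. Conversely `p.1 ^ 2 ≤ p.2` leaves only
that point when `0 < p.2` fails. -/
theorem signedGraph_inter_union_kernelValue_eq_image (A : Matrix (Fin n) (Fin n) ℂ)
    {c : EuclideanSpace ℂ (Fin n) → ℝ} (hc : VanishesOnCollinear A c) {σ : ℝ}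
    (hσ : σ = 1 ∨ σ = -1) :
    signedGraph A c ∩ {z | 0 ≤ σ * z.im} ∪ kernelValue A =
      arcPoint σ '' gainRange A (fun x => σ * c x) := by
  rw [signedGraph_inter_eq_image A hc hσ]
  ext z
  constructor
  · rintro (⟨p, hp, rfl⟩ | hz)
    · exact ⟨p, hp.1, rfl⟩
    · obtain ⟨rfl, x, hx, hAx⟩ := mem_kernelValue.1 hz
      refine ⟨(0, 0), ⟨x, hx, ?_, by simp [hAx], by simp [hAx]⟩, ?_⟩
      · simp [hc x (by simp [hAx])]
      · apply Complex.ext <;> simp [arcPoint]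
  · rintro ⟨p, hp, rfl⟩
    by_cases h : 0 < p.2
    · exact Or.inl ⟨p, ⟨hp, h⟩, rfl⟩
    · have h1 := sq_le_of_mem_gainRange hp
      have h2 : p.2 = 0 := by nlinarith [sq_nonneg p.1]
      have h3 : p.1 = 0 := by
        rw [h2] at h1
        exact pow_eq_zero_iff two_ne_zero |>.1 (le_antisymm h1 (sq_nonneg _))
      obtain ⟨x, hx, -, -, h4⟩ := hp
      refine Or.inr (mem_kernelValue.2 ⟨?_, x, hx, ?_⟩)
      · apply Complex.ext <;> simp [arcPoint, h2, h3]
      · simpa [h2] using h4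

/-- Each half of a signed graph, with or without the kernel value, is parametrized by a convex
set. -/
theorem exists_convex_arcPoint_image (A : Matrix (Fin n) (Fin n) ℂ)
    {c : EuclideanSpace ℂ (Fin n) → ℝ} (hc : VanishesOnCollinear A c) (hc' : IsHermitianForm c)
    {σ : ℝ} (hσ : σ = 1 ∨ σ = -1) {S : Set ℂ}
    (hS : S = signedGraph A c ∩ {z | 0 ≤ σ * z.im} ∨
      S = signedGraph A c ∩ {z | 0 ≤ σ * z.im} ∪ kernelValue A) :
    ∃ Q : Set (ℝ × ℝ), Convex ℝ Q ∧ (∀ p ∈ Q, p.1 ^ 2 ≤ p.2) ∧ S = arcPoint σ '' Q := by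
  have hconv := convex_gainRange A (hc'.const_mul σ)
  rcases hS with rfl | rfl
  · refine ⟨_, hconv.inter ?_, fun p hp => sq_le_of_mem_gainRange hp.1,
      signedGraph_inter_eq_image A hc hσ⟩
    exact convex_halfSpace_gt (f := fun p : ℝ × ℝ => p.2) ⟨fun _ _ => rfl, fun _ _ => rfl⟩ 0
  · exact ⟨_, hconv, fun p hp => sq_le_of_mem_gainRange hp,
      signedGraph_inter_union_kernelValue_eq_image A hc hσ⟩

/-! ### Convex parameter sets for the halves of the graphs -/

theorem upperHalf_eq : upperHalf = {z | 0 ≤ (1 : ℝ) * z.im} := by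
  simp [upperHalf]

theorem lowerHalf_eq : lowerHalf = {z | 0 ≤ (-1 : ℝ) * z.im} := by
  simp [lowerHalf]

theorem srgThetaPlus_eq_rotate (θ : ℝ) (A : Matrix (Fin n) (Fin n) ℂ) :
    srgThetaPlus θ A = rotate θ (srg (exp (-(I * (θ : ℂ))) • A) ∩ upperHalf) :=
  (Set.image_inter (mul_right_injective₀ (exp_ne_zero _))).symm

theorem kernelValue_eq_rotate (θ : ℝ) (A : Matrix (Fin n) (Fin n) ℂ) :
    kernelValue A = rotate θ (kernelValue (exp (-(I * (θ : ℂ))) • A)) := by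
  ext z
  simp only [rotate, Set.mem_image, mem_kernelValue, map_smul, LinearMap.smul_apply, smul_eq_zero,
    exp_ne_zero, false_or]
  constructor
  · rintro ⟨rfl, h⟩
    exact ⟨0, ⟨rfl, h⟩, mul_zero _⟩
  · rintro ⟨_, ⟨rfl, h⟩, rfl⟩
    exact ⟨mul_zero _, h⟩

theorem isHermitianForm_zero {E : Type*} [NormedAddCommGroup E] [InnerProductSpace ℂ E] :
    IsHermitianForm (0 : E → ℝ) := fun _ _ => ⟨0, by simp⟩

theorem exists_convex_srgThetaPlus (θ : ℝ) (A : Matrix (Fin n) (Fin n) ℂ) {S : Set ℂ}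
    (hS : S = srgThetaPlus θ A ∨ S = srgThetaPlus θ A ∪ kernelValue A) :
    ∃ Q : Set (ℝ × ℝ), Convex ℝ Q ∧ (∀ p ∈ Q, p.1 ^ 2 ≤ p.2) ∧
      S = rotate θ (arcPoint 1 '' Q) := by
  have key := fun S => exists_convex_arcPoint_image (exp (-(I * (θ : ℂ))) • A) (c := 0)
    (fun _ _ => rfl) isHermitianForm_zero (Or.inl rfl) (S := S)
  rw [← srg_eq_signedGraph, ← upperHalf_eq] at key
  rw [kernelValue_eq_rotate θ A, srgThetaPlus_eq_rotate, rotate, rotate, ← Set.image_union] at hS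
  rcases hS with rfl | rfl
  · obtain ⟨Q, h1, h2, h3⟩ := key _ (Or.inl rfl)
    exact ⟨Q, h1, h2, by rw [h3]; rfl⟩
  · obtain ⟨Q, h1, h2, h3⟩ := key _ (Or.inr rfl)
    exact ⟨Q, h1, h2, by rw [h3]; rfl⟩

theorem exists_convex_ssg (A : Matrix (Fin n) (Fin n) ℂ) {S : Set ℂ}
    (hS : S = ssgPI A ∨ S = ssgPI A ∪ kernelValue A ∨ S = ssgNI A ∨ S = ssgNI A ∪ kernelValue A) :
    ∃ σ : ℝ, σ ^ 2 = 1 ∧ ∃ Q : Set (ℝ × ℝ), Convex ℝ Q ∧ (∀ p ∈ Q, p.1 ^ 2 ≤ p.2) ∧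
      S = arcPoint σ '' Q := by
  rw [ssgPI, ssgNI, upperHalf_eq, lowerHalf_eq, ssg_eq_signedGraph] at hS
  have key := fun (σ : ℝ) (hσ : σ = 1 ∨ σ = -1) => exists_convex_arcPoint_image A
    (vanishesOnCollinear_im A) (isHermitianForm_im _) hσ (S := S)
  rcases hS with h | h | h | h
  · exact ⟨1, by norm_num, key 1 (Or.inl rfl) (Or.inl h)⟩
  · exact ⟨1, by norm_num, key 1 (Or.inl rfl) (Or.inr h)⟩
  · exact ⟨-1, by norm_num, key (-1) (Or.inr rfl) (Or.inl h)⟩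
  · exact ⟨-1, by norm_num, key (-1) (Or.inr rfl) (Or.inr h)⟩

end Gain

end Texture

theorem mainTheorem11 {n : ℕ} (A : Matrix (Fin n) (Fin n) ℂ) :
    (∀ (θ : ℝ) (S : Set ℂ),
      (S = Texture.srgThetaPlus θ A ∨
        S = Texture.srgThetaPlus θ A ∪ Texture.kernelValue A) →
      Texture.HasTexture (Texture.grating (θ - Real.pi / 2)) S ∧
      ∀ r : ℝ, Texture.HasTexture
        (Texture.ripple ((r : ℂ) * Complex.exp (Complex.I * (θ : ℂ)))) S) ∧
    (∀ S : Set ℂ,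
      (S = Texture.ssgPI A ∨ S = Texture.ssgPI A ∪ Texture.kernelValue A ∨
        S = Texture.ssgNI A ∨ S = Texture.ssgNI A ∪ Texture.kernelValue A) →
      Texture.HasTexture (Texture.grating (Real.pi / 2)) S ∧
      ∀ c : ℝ, Texture.HasTexture (Texture.ripple (c : ℂ)) S) ∧
    Texture.HasTexture Texture.radar (Texture.nnr A) := by
  refine ⟨fun θ S hS => ?_, fun S hS => ?_, Texture.hasTexture_radar_nnr A⟩
  · obtain ⟨Q, hQ, hQ', rfl⟩ := Texture.exists_convex_srgThetaPlus θ A hS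
    exact ⟨Texture.hasTexture_grating_rotate_arcPoint hQ 1 θ,
      Texture.hasTexture_ripple_rotate_arcPoint hQ hQ' (one_pow 2) θ⟩
  · obtain ⟨σ, hσ, Q, hQ, hQ', rfl⟩ := Texture.exists_convex_ssg A hS
    exact ⟨Texture.hasTexture_grating_arcPoint hQ σ,
      Texture.hasTexture_ripple_arcPoint hQ hQ' hσ⟩
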